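/- Let $J=\begin{pmatrix}0&0&1\\0&1&0\\1&0&0\end{pmatrix}$, let $\langle z,w\rangle=w^*Jz$ be the associated Hermitian form on $\mathbb C^3$ (of signature $(2,1)$), and let $\mathrm{SU}(J)=\{A\in\mathrm{SL}(3,\mathbb C): A^*JA=J\}$. An element $A$ is loxodromic if its eigenvalues $\lambda_A,\mu_A,\nu_A$ satisfy $|\lambda_A|>|\mu_A|>|\nu_A|$; write $\mathbf a_A,\mathbf r_A$ for (arbitrarily chosen) eigenvectors of $A$ for $\lambda_A$ and $\nu_A$ respectively. For loxodromic $A,B\in \mathrm{SU}(J)$ put $$\mathbb X_1=\frac{\langle\mathbf r_A,\mathbf a_B\rangle\langle\mathbf r_B,\mathbf a_A\rangle}{\langle\mathbf r_B,\mathbf a_B\rangle\langle\mathbf r_A,\mathbf a_A\rangle},\quad \mathbb X_2=\frac{\langle\mathbf a_A,\mathbf a_B\rangle\langle\mathbf r_B,\mathbf r_A\rangle}{\langle\mathbf r_B,\mathbf a_B\rangle\langle\mathbf a_A,\mathbf r_A\rangle},\quad \mathbb X_3=\frac{\langle\mathbf a_B,\mathbf a_A\rangle\langle\mathbf r_B,\mathbf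 r_A\rangle}{\langle\mathbf r_B,\mathbf a_A\rangle\langle\mathbf a_B,\mathbf r_A\rangle},$$ the last one when $\langle\mathbf r_B,\mathbf a_A\rangle\neq0$ and $\langle\mathbf a_B,\mathbf r_A\rangle\ne0$. Put $C=(AB)^{-1}$, $\sigma_+=\mathrm{tr}(A^{-1}B)-\mathrm{tr}(A^{-1})\mathrm{tr}(B)$, $\sigma_-=\mathrm{tr}(B^{-1}A)-\mathrm{tr}(B^{-1})\mathrm{tr}(A)$, $[A,B]=ABA^{-1}B^{-1}$, and let $$y=(y_1,\dots,y_8)=\bigl(\mathrm{tr}A,\mathrm{tr}B,\mathrm{tr}C,\sigma_+,\mathrm{tr}A^{-1},\mathrm{tr}B^{-1},\mathrm{tr}C^{-1},\sigma_-\bigr).$$ The commutator quadratic of $(A,B)$ is $Q(X)=X^2-S(y)X+P(y)$, where $$S=y_1y_5+y_2y_6+y_3y_7+y_4y_8-y_1y_2y_3-y_5y_6y_7-3,$$ $$\begin{aligned}P={}&y_1y_2y_3y_5y_6y_7+y_1^2y_2^2y_7+y_3y_5^2y_6^2+y_1^2y_3^2y_6+y_2y_5^2y_7^2+y_2^2y_3^2y_5+y_1y_6^2y_7^2\\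 &+y_1y_2y_5y_6+y_2y_3y_6y_7+y_1y_3y_5y_7-2y_1y_2y_7^2-2y_3^2y_5y_6-2y_1y_3y_6^2-2y_2^2y_5y_7-2y_2y_3y_5^2-2y_1^2y_6y_7\\ &+y_1^3+y_2^3+y_3^3+y_5^3+y_6^3+y_7^3+3y_1y_2y_3+3y_5y_6y_7-6y_1y_5-6y_2y_6-6y_3y_7\\ &+y_1y_2y_4y_5y_7+y_1y_3y_4y_6y_7+y_2y_3y_4y_5y_6+y_1y_2^2y_4+y_4y_5^2y_6+y_1^2y_3y_4+y_4y_5y_7^2+y_2y_3^2y_4+y_4y_6^2y_7\\ &+y_1y_3y_5y_6y_8+y_2y_3y_5y_7y_8+y_1y_2y_6y_7y_8+y_5y_6^2y_8+y_1^2y_2y_8+y_5^2y_7y_8+y_1y_3^2y_8+y_6y_7^2y_8+y_2^2y_3y_8\\ &+(y_4^2-3y_8)(y_1y_7+y_2y_5+y_3y_6)+(y_8^2-3y_4)(y_1y_6+y_2y_7+y_3y_5)+y_4y_8(y_1y_5+y_2y_6+y_3y_7-6)+y_4^3+y_8^3+9.\end{aligned}$$ Proposition. (1) The denominators of $\mathbb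 X_1,\mathbb X_2$ never vanish. There are a map $\tau$, restricting to a bijection from $\{\lambda\in\mathbb C:|\lambda|>1\}$ onto the set of traces of loxodromic elements of $\mathrm{SU}(J)$, and, for all $\lambda,\lambda'\in\mathbb C$, a real-affine bijection $\varphi_{\lambda,\lambda'}:\mathbb C^2\to\mathbb C^2$ depending only on $\lambda,\lambda'$, such that for all loxodromic $A,B\in\mathrm{SU}(J)$ $$\mathrm{tr}A=\tau(\lambda_A),\qquad \mathrm{tr}B=\tau(\lambda_B),\qquad (\mathrm{tr}\,C,\sigma_+)=\varphi_{\lambda_A,\lambda_B}(\mathbb X_1,\mathbb X_2).$$ The map $(\lambda,\lambda',x_1,x_2)\mapsto(\tau(\lambda),\tau(\lambda'),\varphi_{\lambda,\lambda'}(x_1,x_2))$ is a bijection from the set of values of $(\lambda_A,\lambda_B,\mathbb X_1,\mathbb X_2)$ onto the set of values of $(\mathrm{tr}A,\mathrm{tr}B,\mathrm{tr}\,C,\sigma_+)$, where $(A,B)$ runs over all pairs of loxodromic elements of $\mathrm{SU}(J)$. (2) For all loxodromic $A,B\in\mathrm{SU}(J)$ the roots of $Q$, with multiplicity, are $\mathrm{tr}[A,B]$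 and $\overline{\mathrm{tr}[A,B]}$. If $\mathbb X_3$ is defined, then $\operatorname{sign}(\operatorname{Im}\mathbb X_3)=-\operatorname{sign}(\operatorname{Im}\mathrm{tr}[A,B])$. If $(A,B)$ and $(A',B')$ are two pairs of loxodromic elements with $\mathbb X_3$ defined and with the same $(\lambda_A,\lambda_B,\mathbb X_1,\mathbb X_2)$, then they have the same $Q$, and the signs of the imaginary parts of their $\mathbb X_3$ agree if and only if $\mathrm{tr}[A,B]=\mathrm{tr}[A',B']$, that is, if and only if they pick the same root of $Q$. -/

import Mathlib

open Matrix Polynomial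
open scoped ComplexConjugate commutatorElement

namespace ParkerPlatis

/-- The matrix `J` of the Hermitian form of signature `(2,1)`. -/
def J : Matrix (Fin 3) (Fin 3) ℂ := !![0, 0, 1; 0, 1, 0; 1, 0, 0]

/-- The Hermitian form `⟨z, w⟩ = w^* J z` (linear in `z`, conjugate linear in `w`). -/
noncomputable def form (z w : Fin 3 → ℂ) : ℂ := star w ⬝ᵥ (J *ᵥ z)

/-- `SU(J)`: the matrices of determinant one that preserve the Hermitian form. -/
def SUJ : Subgroup (SpecialLinearGroup (Fin 3) ℂ) where
  carrier := {A | (A : Matrix (Fin 3) (Fin 3) ℂ)ᴴ * J * (A : Matrix (Fin 3) (Fin 3) ℂ) = J}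
  one_mem' := by
    change (1 : Matrix (Fin 3) (Fin 3) ℂ)ᴴ * J * 1 = J
    simp
  mul_mem' := by
    intro A B hA hB
    change A.1ᴴ * J * A.1 = J at hA
    change B.1ᴴ * J * B.1 = J at hB
    change (A.1 * B.1)ᴴ * J * (A.1 * B.1) = J
    calc _ = B.1ᴴ * (A.1ᴴ * J * A.1) * B.1 := by
            simp only [conjTranspose_mul, Matrix.mul_assoc]
      _ = J := by rw [hA, hB]
  inv_mem' := by
    intro A hA
    change A.1ᴴ * J * A.1 = J at hA
    have h : A.1 * A⁻¹.1 = 1 := congrArg Subtype.val (mul_inv_cancel A)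
    have h' : A⁻¹.1ᴴ * A.1ᴴ = 1 := by rw [← conjTranspose_mul, h, conjTranspose_one]
    change A⁻¹.1ᴴ * J * A⁻¹.1 = J
    calc _ = A⁻¹.1ᴴ * (A.1ᴴ * J * A.1) * A⁻¹.1 := by rw [hA]
      _ = (A⁻¹.1ᴴ * A.1ᴴ) * J * (A.1 * A⁻¹.1) := by simp only [Matrix.mul_assoc]
      _ = J := by rw [h, h', Matrix.one_mul, Matrix.mul_one]

/-- The trace of an element of `SL(3, ℂ)`. -/
noncomputable def tr (A : SpecialLinearGroup (Fin 3) ℂ) : ℂ :=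
  (A : Matrix (Fin 3) (Fin 3) ℂ).trace

/-- The eigenvalues of `A`, with algebraic multiplicity, are `l, m, n`, and `|l| > |m| > |n|`. -/
def HasOrderedEigenvalues (A : SpecialLinearGroup (Fin 3) ℂ) (l m n : ℂ) : Prop :=
  (A : Matrix (Fin 3) (Fin 3) ℂ).charpoly.roots = {l, m, n} ∧ ‖m‖ < ‖l‖ ∧ ‖n‖ < ‖m‖

/-- `A` is loxodromic: its eigenvalues have pairwise different absolute values. -/
def IsLoxodromic (A : SpecialLinearGroup (Fin 3) ℂ) : Prop :=
  ∃ l m n : ℂ, HasOrderedEigenvalues A l m n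

/-- A loxodromic element `A` of `SU(J)` with its eigenvalues `|l| > |m| > |n|`, a chosen attracting
eigenvector `a` (for the eigenvalue `l`) and a chosen repelling eigenvector `r` (for `n`). -/
structure Loxodromic where
  A : SpecialLinearGroup (Fin 3) ℂ
  l : ℂ
  m : ℂ
  n : ℂ
  a : Fin 3 → ℂ
  r : Fin 3 → ℂ
  mem : A ∈ SUJ
  eigenvalues : HasOrderedEigenvalues A l m n
  a_ne : a ≠ 0
  r_ne : r ≠ 0
  a_eigen : (A : Matrix (Fin 3) (Fin 3) ℂ) *ᵥ a = l • a
  r_eigen : (A : Matrix (Fin 3) (Fin 3) ℂ) *ᵥ r = n • r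

/-- Every loxodromic element of `SU(J)` occurs in the preceding structure. -/
theorem exists_loxodromic {A : SpecialLinearGroup (Fin 3) ℂ} (hA : A ∈ SUJ)
    (h : IsLoxodromic A) : ∃ E : Loxodromic, E.A = A := by
  obtain ⟨l, m, n, h⟩ := h
  have key : ∀ k ∈ (A : Matrix (Fin 3) (Fin 3) ℂ).charpoly.roots,
      ∃ v : Fin 3 → ℂ, v ≠ 0 ∧ (A : Matrix (Fin 3) (Fin 3) ℂ) *ᵥ v = k • v := by
    intro k hk
    have hroot := (mem_roots'.1 hk).2
    have hev : Module.End.HasEigenvalue (Matrix.toLin' (A : Matrix (Fin 3) (Fin 3) ℂ)) k := by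
      rw [Module.End.hasEigenvalue_iff_isRoot_charpoly, Matrix.charpoly_toLin']
      exact hroot
    obtain ⟨v, hv⟩ := hev.exists_hasEigenvector
    exact ⟨v, hv.2, by simpa using hv.apply_eq_smul⟩
  obtain ⟨a, ha, ha'⟩ := key l (by rw [h.1]; simp)
  obtain ⟨r, hr, hr'⟩ := key n (by rw [h.1]; simp)
  exact ⟨⟨A, l, m, n, a, r, hA, h, ha, hr, ha', hr'⟩, rfl⟩

/-- The cross-ratio `X₁` of the eigenvectors of `A` and `B`. -/
noncomputable def X1 (E F : Loxodromic) : ℂ :=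
  (form E.r F.a * form F.r E.a) / (form F.r F.a * form E.r E.a)

/-- The cross-ratio `X₂` of the eigenvectors of `A` and `B`. -/
noncomputable def X2 (E F : Loxodromic) : ℂ :=
  (form E.a F.a * form F.r E.r) / (form F.r F.a * form E.a E.r)

/-- The cross-ratio `X₃` of the eigenvectors of `A` and `B`; it is defined when
`⟨r_B, a_A⟩` and `⟨a_B, r_A⟩` are nonzero. -/
noncomputable def X3 (E F : Loxodromic) : ℂ :=
  (form F.a E.a * form F.r E.r) / (form F.r E.a * form F.a E.r)

/-- `σ₊ = tr(A⁻¹B) - tr(A⁻¹) tr(B)`. -/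
noncomputable def sigmaPlus (A B : SpecialLinearGroup (Fin 3) ℂ) : ℂ :=
  tr (A⁻¹ * B) - tr A⁻¹ * tr B

/-- `σ₋ = tr(B⁻¹A) - tr(B⁻¹) tr(A)`. -/
noncomputable def sigmaMinus (A B : SpecialLinearGroup (Fin 3) ℂ) : ℂ :=
  tr (B⁻¹ * A) - tr B⁻¹ * tr A

/-- `(λ_A, λ_B, X₁, X₂)`. -/
noncomputable def eigenCoords (E F : Loxodromic) : ℂ × ℂ × ℂ × ℂ :=
  (E.l, F.l, X1 E F, X2 E F)

/-- `(tr A, tr B, tr C, σ₊)` where `C = (AB)⁻¹`. -/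
noncomputable def traceCoords (A B : SpecialLinearGroup (Fin 3) ℂ) : ℂ × ℂ × ℂ × ℂ :=
  (tr A, tr B, tr (A * B)⁻¹, sigmaPlus A B)

/-- The polynomial giving the sum of the roots of the commutator quadratic. -/
def S (y₁ y₂ y₃ y₄ y₅ y₆ y₇ y₈ : ℂ) : ℂ :=
  y₁ * y₅ + y₂ * y₆ + y₃ * y₇ + y₄ * y₈ - y₁ * y₂ * y₃ - y₅ * y₆ * y₇ - 3

/-- The polynomial giving the product of the roots of the commutator quadratic. -/
def P (y₁ y₂ y₃ y₄ y₅ y₆ y₇ y₈ : ℂ) : ℂ :=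
  y₁ * y₂ * y₃ * y₅ * y₆ * y₇
  + y₁ ^ 2 * y₂ ^ 2 * y₇ + y₃ * y₅ ^ 2 * y₆ ^ 2
  + y₁ ^ 2 * y₃ ^ 2 * y₆ + y₂ * y₅ ^ 2 * y₇ ^ 2
  + y₂ ^ 2 * y₃ ^ 2 * y₅ + y₁ * y₆ ^ 2 * y₇ ^ 2
  + y₁ * y₂ * y₅ * y₆ + y₂ * y₃ * y₆ * y₇ + y₁ * y₃ * y₅ * y₇
  - 2 * y₁ * y₂ * y₇ ^ 2 - 2 * y₃ ^ 2 * y₅ * y₆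
  - 2 * y₁ * y₃ * y₆ ^ 2 - 2 * y₂ ^ 2 * y₅ * y₇
  - 2 * y₂ * y₃ * y₅ ^ 2 - 2 * y₁ ^ 2 * y₆ * y₇
  + y₁ ^ 3 + y₂ ^ 3 + y₃ ^ 3 + y₅ ^ 3 + y₆ ^ 3 + y₇ ^ 3
  + 3 * y₁ * y₂ * y₃ + 3 * y₅ * y₆ * y₇ - 6 * y₁ * y₅ - 6 * y₂ * y₆ - 6 * y₃ * y₇
  + y₁ * y₂ * y₄ * y₅ * y₇ + y₁ * y₃ * y₄ * y₆ * y₇ + y₂ * y₃ * y₄ * y₅ * y₆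
  + y₁ * y₂ ^ 2 * y₄ + y₄ * y₅ ^ 2 * y₆ + y₁ ^ 2 * y₃ * y₄
  + y₄ * y₅ * y₇ ^ 2 + y₂ * y₃ ^ 2 * y₄ + y₄ * y₆ ^ 2 * y₇
  + y₁ * y₃ * y₅ * y₆ * y₈ + y₂ * y₃ * y₅ * y₇ * y₈ + y₁ * y₂ * y₆ * y₇ * y₈
  + y₅ * y₆ ^ 2 * y₈ + y₁ ^ 2 * y₂ * y₈ + y₅ ^ 2 * y₇ * y₈
  + y₁ * y₃ ^ 2 * y₈ + y₆ * y₇ ^ 2 * y₈ + y₂ ^ 2 * y₃ * y₈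
  + (y₄ ^ 2 - 3 * y₈) * (y₁ * y₇ + y₂ * y₅ + y₃ * y₆)
  + (y₈ ^ 2 - 3 * y₄) * (y₁ * y₆ + y₂ * y₇ + y₃ * y₅)
  + y₄ * y₈ * (y₁ * y₅ + y₂ * y₆ + y₃ * y₇ - 6) + y₄ ^ 3 + y₈ ^ 3 + 9

/-- The commutator quadratic `Q = X² - S(y) X + P(y)`, where `y` consists of the traces of `A`, `B`,
`C = (AB)⁻¹` and of their inverses and of the shape invariants `σ₊`, `σ₋`. -/
noncomputable def Q (A B : SpecialLinearGroup (Fin 3) ℂ) : ℂ[X] :=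
  X ^ 2
  - C (S (tr A) (tr B) (tr (A * B)⁻¹) (sigmaPlus A B)
        (tr A⁻¹) (tr B⁻¹) (tr (A * B)) (sigmaMinus A B)) * X
  + C (P (tr A) (tr B) (tr (A * B)⁻¹) (sigmaPlus A B)
        (tr A⁻¹) (tr B⁻¹) (tr (A * B)) (sigmaMinus A B))

/-- The cross-ratio `X₃` is defined: its denominator does not vanish. -/
def X3Defined (E F : Loxodromic) : Prop :=
  form F.r E.a ≠ 0 ∧ form F.a E.r ≠ 0

end ParkerPlatis

/-!
The eigenvectors `a`, `e`, `r` of a loxodromic `A` satisfy `⟨a, a⟩ = ⟨r, r⟩ = 0` and `e ⟂ a, r`.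
Hence `A = m + (l - m) 𝒜 + (n - m) ℛ` with rank-one projections `𝒜 = ⟨·, r⟩ a / ⟨a, r⟩` and
`ℛ = ⟨·, a⟩ r / ⟨r, a⟩`, and `X₁`, `X₂` and their conjugates are the traces of the products of such
a projection of `A` with one of `B`. So `tr (A * B)` and `tr (A⁻¹ * B)` are real-affine functions of
`(X₁, X₂)`. Their linear part is assembled from the matrices with rows `(p, q)`, `(conj q, conj p)`
where `p = l - m` and `q = n - m`, one for `A` and one for `B`, and is invertible as `|q| < |p|`.

For the commutator quadratic take `A` diagonal. Then `tr ⁅A, B⁆` and `tr ⁅B, A⁆` are linear in the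
array with entries `Bᵢⱼ (B⁻¹)ⱼᵢ`, all of whose rows and columns have sum one. The symmetric part of
such a `3 × 3` array is determined by its diagonal, and its antisymmetric part by one number `δ`,
where `δ²` is a polynomial in the diagonals of `B` and `B⁻¹` because `B⁻¹` is the adjugate of `B`.
This expresses the sum and the product of `tr ⁅A, B⁆` and `tr ⁅B, A⁆` through the traces, and on
`SU(J)` the two numbers are conjugate.

Replacing first `A` and then `B` by their projections in `tr ⁅A, B⁆ - tr ⁅B, A⁆` pulls out two
positive factors and leaves `|X₁|² (conj X₃ - X₃)`, which gives the sign of the imaginary part.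
-/

namespace ParkerPlatis

section RelativeGain

variable {n R : Type*} [Fintype n] [DecidableEq n] [CommRing R]

/-- The relative gain array `B ⊙ (B⁻¹)ᵀ`: it carries all the information on `B` that enters the
trace of a commutator of `B` with a diagonal matrix. -/
def relativeGain (B : SpecialLinearGroup n R) : Matrix n n R := B.1 ⊙ (B⁻¹.1)ᵀ

theorem relativeGain_apply (B : SpecialLinearGroup n R) (i j : n) :
    relativeGain B i j = B.1 i j * B⁻¹.1 j i := rfl

theorem relativeGain_inv (B : SpecialLinearGroup n R) :
    relativeGain B⁻¹ = (relativeGain B)ᵀ := by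
  ext i j
  simp only [relativeGain_apply, inv_inv, transpose_apply, mul_comm]

theorem coe_mul_coe_inv (B : SpecialLinearGroup n R) : B.1 * B⁻¹.1 = 1 :=
  congrArg Subtype.val (mul_inv_cancel B)

theorem sum_relativeGain_row (B : SpecialLinearGroup n R) (i : n) :
    ∑ j, relativeGain B i j = 1 := by
  simpa only [mul_apply, one_apply_eq, relativeGain_apply] using congrFun₂ (coe_mul_coe_inv B) i i

theorem sum_relativeGain_col (B : SpecialLinearGroup n R) (j : n) :
    ∑ i, relativeGain B i j = 1 := by
  simpa only [relativeGain_inv, transpose_apply] using sum_relativeGain_row B⁻¹ j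

theorem trace_diagonal_mul_conj_diagonal (u v : n → R) (B : SpecialLinearGroup n R) :
    (diagonal u * B.1 * diagonal v * B⁻¹.1).trace = u ᵥ* relativeGain B ⬝ᵥ v := by
  rw [relativeGain, dotProduct_vecMul_hadamard, transpose_mul, diagonal_transpose,
    transpose_transpose, ← Matrix.mul_assoc]

end RelativeGain

section RelativeGainThree

variable {R : Type*} [CommRing R] (B : SpecialLinearGroup (Fin 3) R)

theorem apply_mul_apply_swap :
    B.1 0 1 * B.1 1 0 = B.1 0 0 * B.1 1 1 - B⁻¹.1 2 2 := by
  simp [adjugate_fin_three]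

theorem relativeGain_mul_swap :
    relativeGain B 0 1 * relativeGain B 1 0 =
      (B.1 0 0 * B.1 1 1 - B⁻¹.1 2 2) * (B⁻¹.1 0 0 * B⁻¹.1 1 1 - B.1 2 2) := by
  have h := apply_mul_apply_swap B⁻¹
  rw [inv_inv] at h
  rw [← apply_mul_apply_swap, ← h, relativeGain_apply, relativeGain_apply]
  ring

variable {i j k : Fin 3}

theorem sum_fin_three_of_ne {M : Type*} [AddCommMonoid M] (hij : i ≠ j) (hjk : j ≠ k)
    (hik : i ≠ k) (f : Fin 3 → M) : ∑ a, f a = f i + f j + f k := by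
  rw [show Finset.univ = {i, j, k} by revert i j k; decide,
    Finset.sum_insert (by simp [hij, hik]), Finset.sum_pair hjk, add_assoc]

theorem relativeGain_add_swap (hij : i ≠ j) (hjk : j ≠ k) (hik : i ≠ k) :
    relativeGain B i j + relativeGain B j i =
      1 - relativeGain B i i - relativeGain B j j + relativeGain B k k := by
  have hi := sum_relativeGain_row B i
  have hj := sum_relativeGain_row B j
  have hk := sum_relativeGain_col B k
  rw [sum_fin_three_of_ne hij hjk hik] at hi hj hk
  linear_combination hi + hj - hk

theorem relativeGain_sub_swap (hij : i ≠ j) (hjk : j ≠ k) (hik : i ≠ k) :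
    relativeGain B i j - relativeGain B j i = relativeGain B j k - relativeGain B k j := by
  have hrow := sum_relativeGain_row B j
  have hcol := sum_relativeGain_col B j
  rw [sum_fin_three_of_ne hij hjk hik] at hrow hcol
  linear_combination hcol - hrow

theorem relativeGain_sub_swap_sq :
    (relativeGain B 1 0 - relativeGain B 0 1) ^ 2 =
      (1 - relativeGain B 0 0 - relativeGain B 1 1 + relativeGain B 2 2) ^ 2
        - 4 * ((B.1 0 0 * B.1 1 1 - B⁻¹.1 2 2) * (B⁻¹.1 0 0 * B⁻¹.1 1 1 - B.1 2 2)) := by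
  rw [← relativeGain_mul_swap,
    ← relativeGain_add_swap B (i := 0) (j := 1) (k := 2) (by decide) (by decide) (by decide)]
  ring

end RelativeGainThree

section Lawton

/-- Here `lᵢ` are the eigenvalues of `A`, and `bᵢ`, `dᵢ` the diagonal entries of `B`, `B⁻¹` in an
eigenbasis of `A`; in these terms `S` is the sum, and `S ^ 2 - 4 * P` the squared difference, of
`tr ⁅A, B⁆` and `tr ⁅B, A⁆`. -/
theorem S_eq_and_four_mul_P_eq {l₁ l₂ l₃ b₁ b₂ b₃ d₁ d₂ d₃ y₁ y₂ y₃ y₄ y₅ y₆ y₇ y₈ : ℂ}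
    (hl : l₁ * l₂ * l₃ = 1) (h₁ : y₁ = l₁ + l₂ + l₃) (h₂ : y₂ = b₁ + b₂ + b₃)
    (h₃ : y₃ = l₁⁻¹ * d₁ + l₂⁻¹ * d₂ + l₃⁻¹ * d₃)
    (h₄ : y₄ = l₁⁻¹ * b₁ + l₂⁻¹ * b₂ + l₃⁻¹ * b₃ - y₅ * y₂)
    (h₅ : y₅ = l₁⁻¹ + l₂⁻¹ + l₃⁻¹) (h₆ : y₆ = d₁ + d₂ + d₃)
    (h₇ : y₇ = l₁ * b₁ + l₂ * b₂ + l₃ * b₃)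
    (h₈ : y₈ = l₁ * d₁ + l₂ * d₂ + l₃ * d₃ - y₆ * y₁) :
    S y₁ y₂ y₃ y₄ y₅ y₆ y₇ y₈ = 2 * (b₁ * d₁ + b₂ * d₂ + b₃ * d₃)
        + (l₁ * l₂⁻¹ + l₂ * l₁⁻¹) * (1 - b₁ * d₁ - b₂ * d₂ + b₃ * d₃)
        + (l₂ * l₃⁻¹ + l₃ * l₂⁻¹) * (1 - b₂ * d₂ - b₃ * d₃ + b₁ * d₁)
        + (l₃ * l₁⁻¹ + l₁ * l₃⁻¹) * (1 - b₃ * d₃ - b₁ * d₁ + b₂ * d₂) ∧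
    4 * P y₁ y₂ y₃ y₄ y₅ y₆ y₇ y₈ = S y₁ y₂ y₃ y₄ y₅ y₆ y₇ y₈ ^ 2
      - ((l₁ - l₂) * (l₂ - l₃) * (l₁ - l₃)) ^ 2
        * ((1 - b₁ * d₁ - b₂ * d₂ + b₃ * d₃) ^ 2
          - 4 * ((b₁ * b₂ - d₃) * (d₁ * d₂ - b₃))) := by
  obtain rfl : l₃ = (l₁ * l₂)⁻¹ := eq_inv_of_mul_eq_one_right hl
  have hl₁ : l₁ ≠ 0 := by rintro rfl; simp at hl
  have hl₂ : l₂ ≠ 0 := by rintro rfl; simp at hl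
  subst h₄ h₈ h₁ h₂ h₃ h₅ h₆ h₇
  clear hl
  simp only [S, P]
  constructor
  · field_simp
    ring
  · field_simp
    ring

theorem prod_eq_one_of_diagonal {n R : Type*} [Fintype n] [DecidableEq n] [CommRing R]
    {A : SpecialLinearGroup n R} {l : n → R} (hA : A.1 = diagonal l) : ∏ i, l i = 1 := by
  rw [← det_diagonal, ← hA, A.2]

theorem coe_inv_eq_diagonal {n K : Type*} [Fintype n] [DecidableEq n] [Field K]
    {A : SpecialLinearGroup n K} {l : n → K} (hA : A.1 = diagonal l) :
    A⁻¹.1 = diagonal fun i => (l i)⁻¹ := by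
  have hl : ∏ i, l i ≠ 0 := by
    rw [prod_eq_one_of_diagonal hA]
    exact one_ne_zero
  refine left_inv_eq_right_inv (mul_eq_one_comm.1 (coe_mul_coe_inv A)) ?_
  rw [hA, diagonal_mul_diagonal, ← diagonal_one]
  congr 1
  funext i
  exact mul_inv_cancel₀ (Finset.prod_ne_zero_iff.1 hl i (Finset.mem_univ i))

variable {A B : SpecialLinearGroup (Fin 3) ℂ} {l : Fin 3 → ℂ}

theorem tr_mul_comm (A B : SpecialLinearGroup (Fin 3) ℂ) : tr (A * B) = tr (B * A) :=
  Matrix.trace_mul_comm A.1 B.1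

theorem tr_commutator_of_diagonal (hA : A.1 = diagonal l) :
    tr ⁅A, B⁆ = l ᵥ* relativeGain B ⬝ᵥ fun i => (l i)⁻¹ := by
  rw [← trace_diagonal_mul_conj_diagonal, ← coe_inv_eq_diagonal hA, ← hA]
  rfl

theorem tr_commutator_swap_of_diagonal (hA : A.1 = diagonal l) :
    tr ⁅B, A⁆ = (fun i => (l i)⁻¹) ᵥ* relativeGain B ⬝ᵥ l := by
  rw [← trace_diagonal_mul_conj_diagonal, ← coe_inv_eq_diagonal hA, ← hA, commutatorElement_def,
    tr_mul_comm, ← mul_assoc, ← mul_assoc]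
  rfl

theorem eigenvalue_ne_zero_of_diagonal (hA : A.1 = diagonal l) :
    l 0 ≠ 0 ∧ l 1 ≠ 0 ∧ l 2 ≠ 0 := by
  have hl := prod_eq_one_of_diagonal hA
  rw [Fin.prod_univ_three] at hl
  refine ⟨?_, ?_, ?_⟩ <;> intro h <;> simp [h] at hl

theorem tr_commutator_add_swap_of_diagonal (hA : A.1 = diagonal l)
    (B : SpecialLinearGroup (Fin 3) ℂ) :
    tr ⁅A, B⁆ + tr ⁅B, A⁆ =
      2 * (relativeGain B 0 0 + relativeGain B 1 1 + relativeGain B 2 2)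
        + (l 0 * (l 1)⁻¹ + l 1 * (l 0)⁻¹)
          * (1 - relativeGain B 0 0 - relativeGain B 1 1 + relativeGain B 2 2)
        + (l 1 * (l 2)⁻¹ + l 2 * (l 1)⁻¹)
          * (1 - relativeGain B 1 1 - relativeGain B 2 2 + relativeGain B 0 0)
        + (l 2 * (l 0)⁻¹ + l 0 * (l 2)⁻¹)
          * (1 - relativeGain B 2 2 - relativeGain B 0 0 + relativeGain B 1 1) := by
  obtain ⟨h₀, h₁, h₂⟩ := eigenvalue_ne_zero_of_diagonal hA
  rw [← relativeGain_add_swap B (i := 0) (j := 1) (k := 2) (by decide) (by decide) (by decide),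
    ← relativeGain_add_swap B (i := 1) (j := 2) (k := 0) (by decide) (by decide) (by decide),
    ← relativeGain_add_swap B (i := 2) (j := 0) (k := 1) (by decide) (by decide) (by decide),
    tr_commutator_of_diagonal hA, tr_commutator_swap_of_diagonal hA]
  simp only [dotProduct, vecMul, Fin.sum_univ_three]
  field_simp
  ring

theorem tr_commutator_sub_swap_of_diagonal (hA : A.1 = diagonal l)
    (B : SpecialLinearGroup (Fin 3) ℂ) :
    tr ⁅A, B⁆ - tr ⁅B, A⁆ = (l 0 - l 1) * (l 1 - l 2) * (l 0 - l 2) *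
      (relativeGain B 1 0 - relativeGain B 0 1) := by
  have hvandermonde : (l 1 * (l 0)⁻¹ - l 0 * (l 1)⁻¹) + (l 2 * (l 1)⁻¹ - l 1 * (l 2)⁻¹)
      + (l 0 * (l 2)⁻¹ - l 2 * (l 0)⁻¹) = (l 0 - l 1) * (l 1 - l 2) * (l 0 - l 2) := by
    obtain ⟨h₀, h₁, h₂⟩ := eigenvalue_ne_zero_of_diagonal hA
    have hl := prod_eq_one_of_diagonal hA
    rw [Fin.prod_univ_three] at hl
    conv_rhs => rw [← div_one (_ * _), ← hl]
    field_simp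
    ring
  have h₁₂ := relativeGain_sub_swap B (i := 0) (j := 1) (k := 2)
    (by decide) (by decide) (by decide)
  have h₂₀ := relativeGain_sub_swap B (i := 1) (j := 2) (k := 0)
    (by decide) (by decide) (by decide)
  rw [← hvandermonde, tr_commutator_of_diagonal hA, tr_commutator_swap_of_diagonal hA]
  simp only [dotProduct, vecMul, Fin.sum_univ_three]
  linear_combination (-(l 1 * (l 2)⁻¹ - l 2 * (l 1)⁻¹) - (l 2 * (l 0)⁻¹ - l 0 * (l 2)⁻¹)) * h₁₂
    - (l 2 * (l 0)⁻¹ - l 0 * (l 2)⁻¹) * h₂₀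

theorem tr_mul_of_diagonal (hA : A.1 = diagonal l) (B : SpecialLinearGroup (Fin 3) ℂ) :
    tr (A * B) = l 0 * B.1 0 0 + l 1 * B.1 1 1 + l 2 * B.1 2 2 := by
  change (A.1 * B.1).trace = _
  rw [hA, trace_fin_three]
  simp only [diagonal_mul]

theorem tr_of_diagonal (hA : A.1 = diagonal l) : tr A = l 0 + l 1 + l 2 := by
  rw [tr, hA, trace_diagonal, Fin.sum_univ_three]

theorem commutator_quadratic_of_diagonal (hA : A.1 = diagonal l)
    (B : SpecialLinearGroup (Fin 3) ℂ) :
    tr ⁅A, B⁆ + tr ⁅B, A⁆ = S (tr A) (tr B) (tr (A * B)⁻¹) (sigmaPlus A B)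
        (tr A⁻¹) (tr B⁻¹) (tr (A * B)) (sigmaMinus A B) ∧
    tr ⁅A, B⁆ * tr ⁅B, A⁆ = P (tr A) (tr B) (tr (A * B)⁻¹) (sigmaPlus A B)
        (tr A⁻¹) (tr B⁻¹) (tr (A * B)) (sigmaMinus A B) := by
  have hl : l 0 * l 1 * l 2 = 1 := by rw [← Fin.prod_univ_three, prod_eq_one_of_diagonal hA]
  have hA' := coe_inv_eq_diagonal hA
  obtain ⟨hS, hP⟩ := S_eq_and_four_mul_P_eq (y₂ := tr B) (y₆ := tr B⁻¹) hl
    (tr_of_diagonal hA) (trace_fin_three B.1)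
    (by rw [_root_.mul_inv_rev, tr_mul_comm, tr_mul_of_diagonal hA'] : tr (A * B)⁻¹ = _)
    (by rw [sigmaPlus, tr_mul_of_diagonal hA'] : sigmaPlus A B = _)
    (tr_of_diagonal hA') (trace_fin_three B⁻¹.1) (tr_mul_of_diagonal hA B)
    (by rw [sigmaMinus, tr_mul_comm, tr_mul_of_diagonal hA] : sigmaMinus A B = _)
  simp only [← relativeGain_apply] at hS hP
  have hsum := (tr_commutator_add_swap_of_diagonal hA B).trans hS.symm
  refine ⟨hsum, ?_⟩
  rw [← relativeGain_sub_swap_sq, ← mul_pow, ← tr_commutator_sub_swap_of_diagonal hA B,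
    ← hsum] at hP
  linear_combination (-1 / 4) * hP

theorem Q_eq_of_diagonal (hA : A.1 = diagonal l) (B : SpecialLinearGroup (Fin 3) ℂ) :
    Q A B = (X - C (tr ⁅A, B⁆)) * (X - C (tr ⁅B, A⁆)) := by
  obtain ⟨hsum, hprod⟩ := commutator_quadratic_of_diagonal hA B
  rw [Q, ← hsum, ← hprod, C_add, C_mul]
  ring

theorem tr_conj (g A : SpecialLinearGroup (Fin 3) ℂ) : tr (MulAut.conj g A) = tr A := by
  rw [MulAut.conj_apply, tr_mul_comm, inv_mul_cancel_left]

theorem Q_conj (g A B : SpecialLinearGroup (Fin 3) ℂ) :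
    Q (MulAut.conj g A) (MulAut.conj g B) = Q A B := by
  simp only [Q, sigmaPlus, sigmaMinus, ← map_mul, ← map_inv, tr_conj]

theorem exists_conj_diagonal {v : Fin 3 → Fin 3 → ℂ} (hv : LinearIndependent ℂ v)
    (hAv : ∀ i, A.1 *ᵥ v i = l i • v i) :
    ∃ g D : SpecialLinearGroup (Fin 3) ℂ, D.1 = diagonal l ∧ MulAut.conj g D = A := by
  have hdet : (of v)ᵀ.det ≠ 0 := by
    rw [det_transpose]
    exact ((isUnit_iff_isUnit_det _).1 (linearIndependent_rows_iff_isUnit.1 hv)).ne_zero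
  obtain ⟨c, hc⟩ := IsAlgClosed.exists_pow_nat_eq (of v)ᵀ.det⁻¹ three_pos
  let g : SpecialLinearGroup (Fin 3) ℂ :=
    ⟨c • (of v)ᵀ, by rw [det_smul, Fintype.card_fin, hc, inv_mul_cancel₀ hdet]⟩
  have hAg : A.1 * g.1 = g.1 * diagonal l := by
    change A.1 * (c • (of v)ᵀ) = c • (of v)ᵀ * diagonal l
    rw [Matrix.mul_smul, Matrix.smul_mul]
    congr 1
    ext i j
    rw [mul_diagonal, transpose_apply, of_apply, mul_comm]
    exact congrFun (hAv j) i
  refine ⟨g, g⁻¹ * A * g, ?_, by rw [MulAut.conj_apply]; group⟩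
  change g⁻¹.1 * A.1 * g.1 = _
  rw [Matrix.mul_assoc, hAg, ← Matrix.mul_assoc, mul_eq_one_comm.1 (coe_mul_coe_inv g),
    Matrix.one_mul]

theorem Q_eq_of_eigenvectors {v : Fin 3 → Fin 3 → ℂ} (hv : LinearIndependent ℂ v)
    (hAv : ∀ i, A.1 *ᵥ v i = l i • v i) (B : SpecialLinearGroup (Fin 3) ℂ) :
    Q A B = (X - C (tr ⁅A, B⁆)) * (X - C (tr ⁅B, A⁆)) := by
  obtain ⟨g, D, hD, rfl⟩ := exists_conj_diagonal hv hAv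
  obtain ⟨B, rfl⟩ := (MulAut.conj g).surjective B
  simp only [← map_commutatorElement, tr_conj, Q_conj, Q_eq_of_diagonal hD]

end Lawton

section HermitianForm

theorem form_apply (z w : Fin 3 → ℂ) :
    form z w = conj (w 0) * z 2 + conj (w 1) * z 1 + conj (w 2) * z 0 := by
  simp [form, J, dotProduct, mulVec, Fin.sum_univ_three]

theorem conj_form (z w : Fin 3 → ℂ) : conj (form z w) = form w z := by
  simp [form_apply]
  ring

theorem form_ne_zero_comm {z w : Fin 3 → ℂ} : form z w ≠ 0 ↔ form w z ≠ 0 := by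
  rw [← conj_form, _root_.map_ne_zero]

theorem form_smul_left (c : ℂ) (x z : Fin 3 → ℂ) : form (c • x) z = c * form x z := by
  simp only [form, mulVec_smul, dotProduct_smul, smul_eq_mul]

theorem form_smul_right (c : ℂ) (x z : Fin 3 → ℂ) : form x (c • z) = conj c * form x z := by
  simp only [form, star_smul, smul_dotProduct, smul_eq_mul, RCLike.star_def]

theorem J_mul_J : J * J = 1 := by
  ext i j
  fin_cases i <;> fin_cases j <;> simp [J, mul_apply, Fin.sum_univ_three]

theorem eq_zero_of_form_eq_zero {z : Fin 3 → ℂ} (h : ∀ w, form w z = 0) : z = 0 := by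
  refine star_eq_zero.1 (dotProduct_eq_zero _ fun w => ?_)
  simpa only [form, mulVec_mulVec, J_mul_J, one_mulVec] using h (J *ᵥ w)

variable {A : SpecialLinearGroup (Fin 3) ℂ}

theorem form_mulVec (hA : A ∈ SUJ) (z w : Fin 3 → ℂ) :
    form (A.1 *ᵥ z) (A.1 *ᵥ w) = form z w := by
  have h : A.1ᴴ * J * A.1 = J := hA
  rw [form, form, star_mulVec, ← dotProduct_mulVec, mulVec_mulVec, mulVec_mulVec, h]

theorem coe_inv_of_mem_SUJ (hA : A ∈ SUJ) : A⁻¹.1 = J * A.1ᴴ * J := by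
  have h : A.1ᴴ * J * A.1 = J := hA
  refine left_inv_eq_right_inv (mul_eq_one_comm.1 (coe_mul_coe_inv A)) (mul_eq_one_comm.1 ?_)
  rw [Matrix.mul_assoc, Matrix.mul_assoc, ← Matrix.mul_assoc A.1ᴴ, h, J_mul_J]

theorem tr_inv (hA : A ∈ SUJ) : tr A⁻¹ = conj (tr A) := by
  rw [tr, coe_inv_of_mem_SUJ hA, Matrix.trace_mul_comm, ← Matrix.mul_assoc, J_mul_J,
    Matrix.one_mul, trace_conjTranspose]
  rfl

theorem mul_conj_eq_one_of_form_ne_zero (hA : A ∈ SUJ) {u v : Fin 3 → ℂ} {x y : ℂ}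
    (hu : A.1 *ᵥ u = x • u) (hv : A.1 *ᵥ v = y • v) (huv : form u v ≠ 0) : x * conj y = 1 := by
  have h := form_mulVec hA u v
  rw [hu, hv, form_smul_left, form_smul_right, ← mul_assoc] at h
  exact mul_eq_right₀ huv |>.1 h

theorem form_eq_zero_of_norm_mul_ne_one (hA : A ∈ SUJ) {u v : Fin 3 → ℂ} {x y : ℂ}
    (hu : A.1 *ᵥ u = x • u) (hv : A.1 *ᵥ v = y • v) (hxy : ‖x‖ * ‖y‖ ≠ 1) : form u v = 0 := by
  by_contra huv
  have h := congrArg norm (mul_conj_eq_one_of_form_ne_zero hA hu hv huv)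
  rw [norm_mul, RCLike.norm_conj, norm_one] at h
  exact hxy h

theorem coe_inv_mulVec {v : Fin 3 → ℂ} {x y : ℂ} (hv : A.1 *ᵥ v = x • v) (hxy : x * y = 1) :
    A⁻¹.1 *ᵥ v = y • v := by
  calc A⁻¹.1 *ᵥ v = y • (A⁻¹.1 *ᵥ (x • v)) := by
        rw [mulVec_smul, smul_smul, mul_comm, hxy, one_smul]
    _ = y • v := by
        rw [← hv, mulVec_mulVec, mul_eq_one_comm.1 (coe_mul_coe_inv A), one_mulVec]

/-- The matrix of the linear map `x ↦ ⟨x, v⟩ u`. -/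
noncomputable def rankOne (u v : Fin 3 → ℂ) : Matrix (Fin 3) (Fin 3) ℂ :=
  vecMulVec u (star v ᵥ* J)

theorem rankOne_mulVec (u v x : Fin 3 → ℂ) : rankOne u v *ᵥ x = form x v • u := by
  rw [rankOne, vecMulVec_mulVec, ← dotProduct_mulVec, op_smul_eq_smul, form]

theorem trace_rankOne (u v : Fin 3 → ℂ) : (rankOne u v).trace = form u v := by
  rw [rankOne, trace_vecMulVec, form, dotProduct_mulVec, dotProduct_comm]

theorem rankOne_mul_rankOne (u v u' v' : Fin 3 → ℂ) :
    rankOne u v * rankOne u' v' = form u' v • rankOne u v' := by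
  rw [rankOne, rankOne, rankOne, vecMulVec_mul_vecMulVec, form, dotProduct_mulVec,
    vecMulVec_smul]

/-- The projection `x ↦ (⟨x, v⟩ / ⟨u, v⟩) u` onto the line of `u` along the orthogonal complement
of `v`; it is meaningful when `⟨u, v⟩ ≠ 0`. -/
noncomputable def proj (u v : Fin 3 → ℂ) : Matrix (Fin 3) (Fin 3) ℂ :=
  (form u v)⁻¹ • rankOne u v

theorem proj_mulVec (u v x : Fin 3 → ℂ) : proj u v *ᵥ x = (form x v / form u v) • u := by
  rw [proj, smul_mulVec, rankOne_mulVec, smul_smul, inv_mul_eq_div]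

theorem trace_proj {u v : Fin 3 → ℂ} (h : form u v ≠ 0) : (proj u v).trace = 1 := by
  rw [proj, trace_smul, trace_rankOne, smul_eq_mul, inv_mul_cancel₀ h]

theorem trace_proj_mul_proj (u v u' v' : Fin 3 → ℂ) :
    (proj u v * proj u' v').trace =
      (form u' v * form u v') / (form u v * form u' v') := by
  simp only [proj, smul_mul_assoc, mul_smul_comm, rankOne_mul_rankOne, trace_smul, trace_rankOne,
    smul_eq_mul]
  ring

theorem trace_proj_mul_proj_mul_proj_mul_proj (u₁ v₁ u₂ v₂ u₃ v₃ u₄ v₄ : Fin 3 → ℂ) :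
    (proj u₁ v₁ * proj u₂ v₂ * proj u₃ v₃ * proj u₄ v₄).trace =
      (form u₂ v₁ * form u₃ v₂ * form u₄ v₃ * form u₁ v₄)
        / (form u₁ v₁ * form u₂ v₂ * form u₃ v₃ * form u₄ v₄) := by
  simp only [proj, smul_mul_assoc, mul_smul_comm, rankOne_mul_rankOne, trace_smul, trace_rankOne,
    smul_eq_mul]
  ring

theorem conj_trace_proj_mul_proj (u v u' v' : Fin 3 → ℂ) :
    conj (proj u v * proj u' v').trace = (proj v u * proj v' u').trace := by
  simp only [trace_proj_mul_proj, map_div₀, map_mul, conj_form]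
  ring

end HermitianForm

namespace Loxodromic

section Eigenvalues

variable (E : Loxodromic)

theorem l_mul_m_mul_n : E.l * E.m * E.n = 1 := by
  have h := det_eq_prod_roots_charpoly E.A.1
  rw [E.A.2, E.eigenvalues.1] at h
  simpa [mul_assoc] using h.symm

theorem tr_eq : tr E.A = E.l + E.m + E.n := by
  rw [tr, trace_eq_sum_roots_charpoly, E.eigenvalues.1]
  simp [add_assoc]

theorem norm_l_mul_norm_m_mul_norm_n : ‖E.l‖ * ‖E.m‖ * ‖E.n‖ = 1 := by
  rw [← norm_mul, ← norm_mul, E.l_mul_m_mul_n, norm_one]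

theorem one_lt_norm_l : 1 < ‖E.l‖ := by
  obtain ⟨-, hml, hnm⟩ := E.eigenvalues
  by_contra! h
  have hlm : ‖E.l‖ * ‖E.m‖ ≤ 1 := mul_le_one₀ h (norm_nonneg _) (hml.le.trans h)
  have hn : ‖E.n‖ < 1 := hnm.trans (hml.trans_le h)
  have := mul_lt_one_of_nonneg_of_lt_one_right hlm (norm_nonneg _) hn
  exact this.ne E.norm_l_mul_norm_m_mul_norm_n

theorem norm_n_lt_one : ‖E.n‖ < 1 := by
  by_contra! h
  have hlm : 1 < ‖E.l‖ * ‖E.m‖ :=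
    one_lt_mul_of_lt_of_le E.one_lt_norm_l (h.trans E.eigenvalues.2.2.le)
  exact (one_lt_mul_of_lt_of_le hlm h).ne' E.norm_l_mul_norm_m_mul_norm_n

end Eigenvalues

section Eigenvectors

variable (E : Loxodromic)

theorem exists_eigenvector_m : ∃ e : Fin 3 → ℂ, e ≠ 0 ∧ E.A.1 *ᵥ e = E.m • e := by
  have hroot : E.A.1.charpoly.IsRoot E.m := by
    refine isRoot_of_mem_roots ?_
    rw [E.eigenvalues.1]
    simp
  rw [← charpoly_toLin', ← Module.End.hasEigenvalue_iff_isRoot_charpoly] at hroot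
  obtain ⟨e, he⟩ := hroot.exists_hasEigenvector
  exact ⟨e, he.2, by simpa only [toLin'_apply] using he.apply_eq_smul⟩

/-- A chosen eigenvector of `E.A` for the middle eigenvalue `E.m`. -/
noncomputable def e : Fin 3 → ℂ := E.exists_eigenvector_m.choose

theorem e_ne : E.e ≠ 0 := E.exists_eigenvector_m.choose_spec.1

theorem e_eigen : E.A.1 *ᵥ E.e = E.m • E.e := E.exists_eigenvector_m.choose_spec.2

theorem mulVec_eigenvector (i : Fin 3) :
    E.A.1 *ᵥ ![E.a, E.e, E.r] i = ![E.l, E.m, E.n] i • ![E.a, E.e, E.r] i := by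
  fin_cases i
  exacts [E.a_eigen, E.e_eigen, E.r_eigen]

theorem linearIndependent_eigenvectors : LinearIndependent ℂ ![E.a, E.e, E.r] := by
  obtain ⟨-, hml, hnm⟩ := E.eigenvalues
  have hinj : Function.Injective ![E.l, E.m, E.n] := by
    refine Function.Injective.of_comp (f := norm) (StrictAnti.injective ?_)
    rw [Fin.strictAnti_iff_succ_lt]
    intro i
    fin_cases i
    exacts [hml, hnm]
  refine Module.End.eigenvectors_linearIndependent' (toLin' E.A.1) _ hinj _ fun i => ?_
  refine ⟨Module.End.mem_eigenspace_iff.2 (E.mulVec_eigenvector i), ?_⟩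
  fin_cases i
  exacts [E.a_ne, E.e_ne, E.r_ne]

theorem matrix_ext {T T' : Matrix (Fin 3) (Fin 3) ℂ} (ha : T *ᵥ E.a = T' *ᵥ E.a)
    (he : T *ᵥ E.e = T' *ᵥ E.e) (hr : T *ᵥ E.r = T' *ᵥ E.r) : T = T' := by
  refine toLin'.injective (LinearMap.ext_on_range
    (E.linearIndependent_eigenvectors.span_eq_top_of_card_eq_finrank (by simp)) fun i => ?_)
  fin_cases i
  exacts [ha, he, hr]

theorem form_a_a : form E.a E.a = 0 :=
  form_eq_zero_of_norm_mul_ne_one E.mem E.a_eigen E.a_eigen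
    (one_lt_mul_of_lt_of_le E.one_lt_norm_l E.one_lt_norm_l.le).ne'

theorem form_r_r : form E.r E.r = 0 :=
  form_eq_zero_of_norm_mul_ne_one E.mem E.r_eigen E.r_eigen
    (mul_lt_one_of_nonneg_of_lt_one_left (norm_nonneg _) E.norm_n_lt_one E.norm_n_lt_one.le).ne

theorem form_e_a : form E.e E.a = 0 := by
  refine form_eq_zero_of_norm_mul_ne_one E.mem E.e_eigen E.a_eigen fun h => ?_
  have hprod := E.norm_l_mul_norm_m_mul_norm_n
  rw [mul_comm ‖E.l‖, h, one_mul] at hprod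
  exact E.norm_n_lt_one.ne hprod

theorem form_e_r : form E.e E.r = 0 := by
  refine form_eq_zero_of_norm_mul_ne_one E.mem E.e_eigen E.r_eigen fun h => ?_
  have hprod := E.norm_l_mul_norm_m_mul_norm_n
  rw [mul_assoc, h, mul_one] at hprod
  exact E.one_lt_norm_l.ne' hprod

theorem form_r_a : form E.r E.a ≠ 0 := by
  intro h
  have hzero : rankOne E.a E.a = 0 := E.matrix_ext
    (by rw [rankOne_mulVec, E.form_a_a, zero_smul, zero_mulVec])
    (by rw [rankOne_mulVec, E.form_e_a, zero_smul, zero_mulVec])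
    (by rw [rankOne_mulVec, h, zero_smul, zero_mulVec])
  refine E.a_ne (eq_zero_of_form_eq_zero fun w => ?_)
  have hw := rankOne_mulVec E.a E.a w
  rw [hzero, zero_mulVec] at hw
  exact (smul_eq_zero.1 hw.symm).resolve_right E.a_ne

theorem form_a_r : form E.a E.r ≠ 0 := form_ne_zero_comm.1 E.form_r_a

end Eigenvectors

section ConjugateEigenvalues

variable (E : Loxodromic)

theorem l_mul_conj_n : E.l * conj E.n = 1 :=
  mul_conj_eq_one_of_form_ne_zero E.mem E.a_eigen E.r_eigen E.form_a_r

theorem n_mul_conj_l : E.n * conj E.l = 1 :=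
  mul_conj_eq_one_of_form_ne_zero E.mem E.r_eigen E.a_eigen E.form_r_a

theorem m_mul_conj_m : E.m * conj E.m = 1 := by
  have h := congrArg conj E.l_mul_m_mul_n
  simp only [map_mul, map_one] at h
  linear_combination conj E.l * conj E.m * conj E.n * E.l_mul_m_mul_n + h
    - E.m * conj E.m * (E.n * conj E.l * E.l_mul_conj_n + E.n_mul_conj_l)

theorem l_ne_zero : E.l ≠ 0 := left_ne_zero_of_mul_eq_one E.l_mul_conj_n

theorem n_eq : E.n = (conj E.l)⁻¹ := eq_inv_of_mul_eq_one_left E.n_mul_conj_l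

theorem m_eq : E.m = conj E.l / E.l := by
  rw [eq_div_iff E.l_ne_zero]
  linear_combination conj E.l * E.l_mul_m_mul_n - E.l * E.m * E.n_mul_conj_l

theorem norm_m : ‖E.m‖ = 1 := by
  rw [E.m_eq, norm_div, RCLike.norm_conj, div_self (norm_ne_zero_iff.2 E.l_ne_zero)]

theorem conj_l_sub_m : conj (E.l - E.m) = E.l * (E.m - E.n) := by
  rw [map_sub]
  linear_combination E.l * E.m * E.n_mul_conj_l - conj E.l * E.l_mul_m_mul_n
    + conj E.m * E.l_mul_m_mul_n - E.l * E.n * E.m_mul_conj_m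

theorem norm_n_sub_m_lt : ‖E.n - E.m‖ < ‖E.l - E.m‖ := by
  have hpos : 0 < ‖E.n - E.m‖ := by
    refine norm_sub_pos_iff.2 fun h => E.eigenvalues.2.2.ne ?_
    rw [h]
  rw [← RCLike.norm_conj (E.l - E.m), conj_l_sub_m, norm_mul, norm_sub_rev E.m]
  exact lt_mul_of_one_lt_left hpos E.one_lt_norm_l

end ConjugateEigenvalues

section Spectral

variable (E : Loxodromic)

/-- The projection onto the attracting line, killing the other two eigenlines. -/
noncomputable def attracting : Matrix (Fin 3) (Fin 3) ℂ := proj E.a E.r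

/-- The projection onto the repelling line, killing the other two eigenlines. -/
noncomputable def repelling : Matrix (Fin 3) (Fin 3) ℂ := proj E.r E.a

theorem attracting_mul_repelling : E.attracting * E.repelling = 0 := by
  rw [attracting, repelling, proj, proj, smul_mul_smul_comm, rankOne_mul_rankOne, E.form_r_r,
    zero_smul, smul_zero]

theorem repelling_mul_attracting : E.repelling * E.attracting = 0 := by
  rw [attracting, repelling, proj, proj, smul_mul_smul_comm, rankOne_mul_rankOne, E.form_a_a,
    zero_smul, smul_zero]

/-- The matrix with eigenvalues `x`, `y`, `z` on the attracting, middle and repelling eigenlines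
of `E.A`. -/
noncomputable def spectral (x y z : ℂ) : Matrix (Fin 3) (Fin 3) ℂ :=
  y • 1 + (x - y) • E.attracting + (z - y) • E.repelling

theorem spectral_mulVec (x y z : ℂ) (v : Fin 3 → ℂ) :
    E.spectral x y z *ᵥ v = y • v + ((x - y) * (form v E.r / form E.a E.r)) • E.a
      + ((z - y) * (form v E.a / form E.r E.a)) • E.r := by
  simp only [spectral, attracting, repelling, add_mulVec, smul_mulVec, proj_mulVec, one_mulVec,
    smul_smul]

variable {E} in
theorem eq_spectral {T : Matrix (Fin 3) (Fin 3) ℂ} {x y z : ℂ} (ha : T *ᵥ E.a = x • E.a)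
    (he : T *ᵥ E.e = y • E.e) (hr : T *ᵥ E.r = z • E.r) : T = E.spectral x y z := by
  refine E.matrix_ext ?_ ?_ ?_
  · rw [ha, spectral_mulVec, E.form_a_a, div_self E.form_a_r]
    module
  · rw [he, spectral_mulVec, E.form_e_a, E.form_e_r]
    module
  · rw [hr, spectral_mulVec, E.form_r_r, div_self E.form_r_a]
    module

theorem coe_eq_spectral : E.A.1 = E.spectral E.l E.m E.n :=
  eq_spectral E.a_eigen E.e_eigen E.r_eigen

theorem coe_inv_eq_spectral : E.A⁻¹.1 = E.spectral (conj E.n) (conj E.m) (conj E.l) :=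
  eq_spectral (coe_inv_mulVec E.a_eigen E.l_mul_conj_n) (coe_inv_mulVec E.e_eigen E.m_mul_conj_m)
    (coe_inv_mulVec E.r_eigen E.n_mul_conj_l)

end Spectral

section Traces

variable (E F : Loxodromic)

theorem X1_eq_trace : X1 E F = (E.repelling * F.repelling).trace := by
  rw [repelling, repelling, trace_proj_mul_proj, X1]
  ring

theorem X2_eq_trace : X2 E F = (E.attracting * F.repelling).trace := by
  rw [attracting, repelling, trace_proj_mul_proj, X2]
  ring

theorem conj_X1_eq_trace : conj (X1 E F) = (E.attracting * F.attracting).trace := by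
  rw [X1_eq_trace, repelling, repelling, conj_trace_proj_mul_proj, attracting, attracting]

theorem conj_X2_eq_trace : conj (X2 E F) = (E.repelling * F.attracting).trace := by
  rw [X2_eq_trace, attracting, repelling, conj_trace_proj_mul_proj, repelling, attracting]

theorem trace_spectral_mul_spectral (x y z x' y' z' : ℂ) :
    (E.spectral x y z * F.spectral x' y' z').trace = y * (x' + z') + y' * (x + z) - y * y'
      + (x - y) * (x' - y') * conj (X1 E F) + (x - y) * (z' - y') * X2 E F
      + (z - y) * (x' - y') * conj (X2 E F) + (z - y) * (z' - y') * X1 E F := by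
  have ha (K : Loxodromic) : K.attracting.trace = 1 := trace_proj K.form_a_r
  have hr (K : Loxodromic) : K.repelling.trace = 1 := trace_proj K.form_r_a
  simp only [spectral, add_mul, mul_add, smul_mul_assoc, mul_smul_comm, Matrix.one_mul,
    Matrix.mul_one, trace_add, trace_smul, smul_eq_mul, trace_one, Fintype.card_fin, ha, hr,
    ← X1_eq_trace, ← X2_eq_trace, ← conj_X1_eq_trace, ← conj_X2_eq_trace]
  push_cast
  ring

theorem tr_mul : tr (E.A * F.A) = E.m * (F.l + F.n) + F.m * (E.l + E.n) - E.m * F.m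
    + (E.l - E.m) * (F.l - F.m) * conj (X1 E F) + (E.l - E.m) * (F.n - F.m) * X2 E F
    + (E.n - E.m) * (F.l - F.m) * conj (X2 E F) + (E.n - E.m) * (F.n - F.m) * X1 E F := by
  rw [← trace_spectral_mul_spectral, ← coe_eq_spectral, ← coe_eq_spectral]
  rfl

theorem tr_inv_mul : tr (E.A⁻¹ * F.A) =
    conj E.m * (F.l + F.n) + F.m * (conj E.n + conj E.l) - conj E.m * F.m
    + (conj E.n - conj E.m) * (F.l - F.m) * conj (X1 E F)
    + (conj E.n - conj E.m) * (F.n - F.m) * X2 E F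
    + (conj E.l - conj E.m) * (F.l - F.m) * conj (X2 E F)
    + (conj E.l - conj E.m) * (F.n - F.m) * X1 E F := by
  rw [← trace_spectral_mul_spectral, ← coe_inv_eq_spectral, ← coe_eq_spectral]
  rfl

end Traces

end Loxodromic

theorem trace_mul_mul_mul_sub_swap {n R : Type*} [Fintype n] [DecidableEq n] [CommRing R]
    {T T' U V M N : Matrix n n R} {y p q y' p' q' : R} (hUV : U * V = V * U)
    (hT : T = y • 1 + p • M + q • N) (hT' : T' = y' • 1 + p' • M + q' • N) :
    (T * U * T' * V).trace - (T' * U * T * V).trace =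
      (p * q' - q * p') * ((M * U * N * V).trace - (N * U * M * V).trace) := by
  have hcomm (K : Matrix n n R) : (U * K * V).trace = (K * U * V).trace := by
    rw [Matrix.mul_assoc, Matrix.trace_mul_comm, Matrix.mul_assoc, ← hUV, Matrix.mul_assoc]
  simp only [hT, hT', add_mul, mul_add, smul_mul_assoc, mul_smul_comm, Matrix.one_mul,
    Matrix.mul_one, trace_add, trace_smul, smul_eq_mul, hcomm]
  ring

namespace Loxodromic

section Sign

variable (E F : Loxodromic)

/-- The Vandermonde product `(l - m) (m - n) (l - n)` of the eigenvalues, which is real on `SU(J)`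
and is written here as the difference of squares that shows its sign. -/
noncomputable def gap : ℝ := ‖E.l - E.m‖ ^ 2 - ‖E.n - E.m‖ ^ 2

theorem gap_pos : 0 < E.gap :=
  sub_pos.2 (pow_lt_pow_left₀ E.norm_n_sub_m_lt (norm_nonneg _) two_ne_zero)

theorem ofReal_gap : (E.gap : ℂ) =
    (E.l - E.m) * (conj E.l - conj E.m) - (E.n - E.m) * (conj E.n - conj E.m) := by
  rw [gap, ← map_sub, ← map_sub, Complex.mul_conj', Complex.mul_conj']
  push_cast
  rfl

theorem trace_mul_mul_inv_mul_sub_swap {U V : Matrix (Fin 3) (Fin 3) ℂ} (hUV : U * V = V * U) :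
    (E.A.1 * U * E.A⁻¹.1 * V).trace - (E.A⁻¹.1 * U * E.A.1 * V).trace =
      E.gap * ((E.attracting * U * E.repelling * V).trace
        - (E.repelling * U * E.attracting * V).trace) := by
  rw [ofReal_gap]
  exact trace_mul_mul_mul_sub_swap hUV E.coe_eq_spectral E.coe_inv_eq_spectral

theorem tr_commutator_sub_swap : tr ⁅E.A, F.A⁆ - tr ⁅F.A, E.A⁆ =
    E.gap * F.gap * ((F.attracting * E.repelling * F.repelling * E.attracting).trace
      - (F.repelling * E.repelling * F.attracting * E.attracting).trace) := by
  have hcycle (M N : Matrix (Fin 3) (Fin 3) ℂ) :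
      (M * F.A.1 * N * F.A⁻¹.1).trace = (F.A⁻¹.1 * M * F.A.1 * N).trace := by
    rw [Matrix.trace_mul_comm]
    simp only [Matrix.mul_assoc]
  calc tr ⁅E.A, F.A⁆ - tr ⁅F.A, E.A⁆
      = (E.A.1 * F.A.1 * E.A⁻¹.1 * F.A⁻¹.1).trace
        - (E.A⁻¹.1 * F.A.1 * E.A.1 * F.A⁻¹.1).trace := by
          rw [commutatorElement_def F.A, tr_mul_comm, ← mul_assoc, ← mul_assoc]
          rfl
    _ = E.gap * ((E.attracting * F.A.1 * E.repelling * F.A⁻¹.1).trace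
        - (E.repelling * F.A.1 * E.attracting * F.A⁻¹.1).trace) :=
          E.trace_mul_mul_inv_mul_sub_swap
            ((coe_mul_coe_inv F.A).trans (mul_eq_one_comm.1 (coe_mul_coe_inv F.A)).symm)
    _ = E.gap * ((F.A.1 * E.repelling * F.A⁻¹.1 * E.attracting).trace
        - (F.A⁻¹.1 * E.repelling * F.A.1 * E.attracting).trace) := by
          rw [hcycle E.repelling, Matrix.mul_assoc, Matrix.mul_assoc, Matrix.trace_mul_comm,
            ← Matrix.mul_assoc]
    _ = _ := by
          rw [F.trace_mul_mul_inv_mul_sub_swap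
            (E.repelling_mul_attracting.trans E.attracting_mul_repelling.symm)]
          ring

theorem trace_repelling_repelling_attracting_attracting (h : X3Defined E F) :
    (F.repelling * E.repelling * F.attracting * E.attracting).trace =
      (‖X1 E F‖ ^ 2 : ℝ) * X3 E F := by
  obtain ⟨hra, har⟩ := h
  rw [repelling, repelling, attracting, attracting, trace_proj_mul_proj_mul_proj_mul_proj, X3,
    Complex.ofReal_pow, ← Complex.mul_conj', X1, map_div₀, map_mul, map_mul, conj_form, conj_form,
    conj_form, conj_form]
  field_simp

theorem trace_attracting_repelling_repelling_attracting :
    (F.attracting * E.repelling * F.repelling * E.attracting).trace =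
      conj (F.repelling * E.repelling * F.attracting * E.attracting).trace := by
  simp only [repelling, attracting, trace_proj_mul_proj_mul_proj_mul_proj, map_div₀, map_mul,
    conj_form]
  ring

theorem tr_commutator_swap {A B : SpecialLinearGroup (Fin 3) ℂ} (hA : A ∈ SUJ) (hB : B ∈ SUJ) :
    tr ⁅B, A⁆ = conj (tr ⁅A, B⁆) := by
  rw [← commutatorElement_inv, tr_inv (Subgroup.commutator_le_self SUJ ?_)]
  exact Subgroup.commutator_mem_commutator hA hB

theorem im_tr_commutator (h : X3Defined E F) :
    (tr ⁅E.A, F.A⁆).im = -(E.gap * F.gap * ‖X1 E F‖ ^ 2 * (X3 E F).im) := by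
  have key := congrArg Complex.im (E.tr_commutator_sub_swap F)
  rw [tr_commutator_swap E.mem F.mem, trace_attracting_repelling_repelling_attracting,
    E.trace_repelling_repelling_attracting_attracting F h, ← Complex.ofReal_mul,
    Complex.im_ofReal_mul] at key
  simp only [map_mul, Complex.conj_ofReal, Complex.sub_im, Complex.conj_im,
    Complex.im_ofReal_mul] at key
  linear_combination key / 2

theorem X1_ne_zero (h : X3Defined E F) : X1 E F ≠ 0 :=
  div_ne_zero (mul_ne_zero (form_ne_zero_comm.1 h.2) h.1) (mul_ne_zero F.form_r_a E.form_r_a)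

theorem sign_im_X3 (h : X3Defined E F) :
    SignType.sign (X3 E F).im = -SignType.sign (tr ⁅E.A, F.A⁆).im := by
  have hpos : 0 < E.gap * F.gap * ‖X1 E F‖ ^ 2 :=
    mul_pos (mul_pos E.gap_pos F.gap_pos) (pow_pos (norm_pos_iff.2 (E.X1_ne_zero F h)) 2)
  rw [E.im_tr_commutator F h, Left.sign_neg, neg_neg, sign_mul, sign_pos hpos, one_mul]

theorem roots_Q {B : SpecialLinearGroup (Fin 3) ℂ} (hB : B ∈ SUJ) :
    (Q E.A B).roots = {tr ⁅E.A, B⁆, conj (tr ⁅E.A, B⁆)} := by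
  rw [Q_eq_of_eigenvectors E.linearIndependent_eigenvectors E.mulVec_eigenvector,
    tr_commutator_swap E.mem hB, roots_mul (mul_ne_zero (X_sub_C_ne_zero _) (X_sub_C_ne_zero _)),
    roots_X_sub_C, roots_X_sub_C]
  rfl

end Sign

end Loxodromic

section TraceCoordinate

/-- The trace of a loxodromic element of `SU(J)` as a function of its eigenvalue `l` of largest
modulus: the other two are then `conj l / l` and `(conj l)⁻¹`. -/
noncomputable def traceOfEigenvalue (l : ℂ) : ℂ := l + conj l / l + (conj l)⁻¹

theorem Loxodromic.tr_eq_traceOfEigenvalue (E : Loxodromic) : tr E.A = traceOfEigenvalue E.l := by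
  rw [E.tr_eq, traceOfEigenvalue, ← E.m_eq, ← E.n_eq]

theorem Loxodromic.conj_tr (E : Loxodromic) :
    conj (tr E.A) = E.l * E.m + E.l * E.n + E.m * E.n := by
  simp only [E.tr_eq, map_add]
  linear_combination (-(conj E.l + conj E.m + conj E.n)) * E.l_mul_m_mul_n
    + E.l * E.m * E.n_mul_conj_l + E.l * E.n * E.m_mul_conj_m + E.m * E.n * E.l_mul_conj_n

theorem Loxodromic.sub_l_mul_sub_m_mul_sub_n (E : Loxodromic) (x : ℂ) :
    (x - E.l) * (x - E.m) * (x - E.n) = x ^ 3 - tr E.A * x ^ 2 + conj (tr E.A) * x - 1 := by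
  rw [E.conj_tr, E.tr_eq, ← E.l_mul_m_mul_n]
  ring

theorem Loxodromic.l_eq_of_tr_eq {E F : Loxodromic} (h : tr E.A = tr F.A) : E.l = F.l := by
  have hroot : (F.l - E.l) * (F.l - E.m) * (F.l - E.n) = 0 := by
    rw [E.sub_l_mul_sub_m_mul_sub_n, h, ← F.sub_l_mul_sub_m_mul_sub_n, sub_self, zero_mul,
      zero_mul]
  have hm : F.l ≠ E.m := fun h => by simpa only [h, E.norm_m, lt_irrefl] using F.one_lt_norm_l
  have hn : F.l ≠ E.n := fun h => lt_asymm F.one_lt_norm_l (h ▸ E.norm_n_lt_one)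
  simpa only [mul_eq_zero, sub_eq_zero, hm, hn, or_false, eq_comm] using hroot

/-- The diagonal element of `SU(J)` with first eigenvalue `l`. -/
noncomputable def diagonalSUJ (l : ℂ) (hl : l ≠ 0) : SpecialLinearGroup (Fin 3) ℂ :=
  ⟨diagonal ![l, conj l / l, (conj l)⁻¹], by
    have hl' : conj l ≠ 0 := (_root_.map_ne_zero _).2 hl
    simp only [det_diagonal, Fin.prod_univ_three, cons_val]
    field_simp⟩

theorem diagonalSUJ_mem {l : ℂ} (hl : l ≠ 0) : diagonalSUJ l hl ∈ SUJ := by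
  have hl' : conj l ≠ 0 := (_root_.map_ne_zero _).2 hl
  change (diagonal ![l, conj l / l, (conj l)⁻¹])ᴴ * J * diagonal ![l, conj l / l, (conj l)⁻¹] = J
  rw [diagonal_conjTranspose]
  ext i j
  fin_cases i <;> fin_cases j <;> simp [J, hl, hl']

theorem hasOrderedEigenvalues_diagonalSUJ {l : ℂ} (hl : l ≠ 0) (h : 1 < ‖l‖) :
    HasOrderedEigenvalues (diagonalSUJ l hl) l (conj l / l) (conj l)⁻¹ := by
  have hm : ‖conj l / l‖ = 1 := by
    rw [norm_div, RCLike.norm_conj, div_self (norm_ne_zero_iff.2 hl)]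
  refine ⟨?_, hm.trans_lt h, ?_⟩
  · change (diagonal ![l, conj l / l, (conj l)⁻¹]).charpoly.roots = _
    rw [charpoly_diagonal, Fin.prod_univ_three,
      roots_mul (by simp [X_sub_C_ne_zero]), roots_mul (by simp [X_sub_C_ne_zero])]
    simp only [roots_X_sub_C]
    rfl
  · rw [hm, norm_inv, RCLike.norm_conj]
    exact inv_lt_one_of_one_lt₀ h

theorem exists_loxodromic_l_eq {l : ℂ} (h : 1 < ‖l‖) : ∃ E : Loxodromic, E.l = l := by
  have hl : l ≠ 0 := norm_pos_iff.1 (one_pos.trans h)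
  have heigen (i : Fin 3) : (diagonalSUJ l hl).1 *ᵥ Pi.single i 1 =
      ![l, conj l / l, (conj l)⁻¹] i • Pi.single i 1 := by
    rw [diagonalSUJ, diagonal_mulVec_single, ← Pi.single_smul, smul_eq_mul]
  exact ⟨⟨diagonalSUJ l hl, l, _, _, Pi.single 0 1, Pi.single 2 1, diagonalSUJ_mem hl,
    hasOrderedEigenvalues_diagonalSUJ hl h, by simp, by simp, heigen 0, heigen 2⟩, rfl⟩

theorem bijOn_traceOfEigenvalue : Set.BijOn traceOfEigenvalue {l : ℂ | 1 < ‖l‖}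
    {t : ℂ | ∃ A ∈ SUJ, IsLoxodromic A ∧ t = tr A} := by
  refine ⟨?_, ?_, ?_⟩
  · intro l hl
    obtain ⟨E, rfl⟩ := exists_loxodromic_l_eq hl
    exact ⟨E.A, E.mem, ⟨_, _, _, E.eigenvalues⟩, E.tr_eq_traceOfEigenvalue.symm⟩
  · intro l hl l' hl' h
    obtain ⟨E, rfl⟩ := exists_loxodromic_l_eq hl
    obtain ⟨F, rfl⟩ := exists_loxodromic_l_eq hl'
    rw [← E.tr_eq_traceOfEigenvalue, ← F.tr_eq_traceOfEigenvalue] at h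
    exact Loxodromic.l_eq_of_tr_eq h
  · rintro t ⟨A, hA, hlox, rfl⟩
    obtain ⟨E, rfl⟩ := exists_loxodromic hA hlox
    exact ⟨E.l, E.one_lt_norm_l, E.tr_eq_traceOfEigenvalue.symm⟩

end TraceCoordinate

section CrossRatioCoordinates

theorem eq_zero_of_conj_system {p q u v : ℂ} (h : ‖q‖ < ‖p‖) (h₁ : p * u + q * v = 0)
    (h₂ : conj q * u + conj p * v = 0) : u = 0 ∧ v = 0 := by
  have hdet : p * conj p - q * conj q ≠ 0 := by
    rw [Complex.mul_conj', Complex.mul_conj', sub_ne_zero]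
    exact_mod_cast (pow_lt_pow_left₀ h (norm_nonneg q) two_ne_zero).ne'
  constructor
  · apply mul_left_cancel₀ hdet
    linear_combination conj p * h₁ - q * h₂
  · apply mul_left_cancel₀ hdet
    linear_combination p * h₂ - conj q * h₁

/-- The real-linear part of the passage from `(X₁, X₂)` to `(tr C, σ₊)`, where `p = l - m` and
`q = n - m` for the eigenvalues of `A`, and `p'`, `q'` are the same differences for `B`. -/
noncomputable def crossRatioLinear (p q p' q' : ℂ) : (ℂ × ℂ) →ₗ[ℝ] (ℂ × ℂ) where
  toFun x := (conj (p * (p' * conj x.1 + q' * x.2) + q * (p' * conj x.2 + q' * x.1)),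
    conj q * (p' * conj x.1 + q' * x.2) + conj p * (p' * conj x.2 + q' * x.1))
  map_add' x y := by
    ext <;> simp only [Prod.fst_add, Prod.snd_add, map_add, map_mul] <;> ring
  map_smul' c x := by
    ext <;> simp only [Prod.smul_fst, Prod.smul_snd, map_add, map_mul, Complex.real_smul,
      Complex.conj_ofReal, RingHom.id_apply] <;> ring

theorem crossRatioLinear_apply (p q p' q' : ℂ) (x : ℂ × ℂ) : crossRatioLinear p q p' q' x =
    (conj (p * (p' * conj x.1 + q' * x.2) + q * (p' * conj x.2 + q' * x.1)),
      conj q * (p' * conj x.1 + q' * x.2) + conj p * (p' * conj x.2 + q' * x.1)) := rfl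

theorem crossRatioLinear_injective {p q p' q' : ℂ} (h : ‖q‖ < ‖p‖) (h' : ‖q'‖ < ‖p'‖) :
    Function.Injective (crossRatioLinear p q p' q') := by
  refine (injective_iff_map_eq_zero _).2 fun x hx => ?_
  rw [crossRatioLinear_apply, Prod.mk_eq_zero, map_eq_zero] at hx
  obtain ⟨hu, hv⟩ := eq_zero_of_conj_system h hx.1 hx.2
  have hv' := congrArg conj hv
  simp only [map_add, map_mul, Complex.conj_conj, map_zero] at hv'
  obtain ⟨hx₁, hx₂⟩ := eq_zero_of_conj_system h' hu ((add_comm _ _).trans hv')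
  exact Prod.ext ((map_eq_zero _).1 hx₁) hx₂

namespace Loxodromic

variable (E F : Loxodromic)

/-- The value of `(tr C, σ₊)` at `(X₁, X₂) = 0`, as a function of the eigenvalues. -/
noncomputable def traceOffset : ℂ × ℂ :=
  (conj (E.m * (F.l + F.n) + F.m * (E.l + E.n) - E.m * F.m),
    conj E.m * (F.l + F.n) + F.m * (conj E.n + conj E.l) - conj E.m * F.m
      - conj (E.l + E.m + E.n) * (F.l + F.m + F.n))

theorem tr_inv_sigmaPlus_eq : (tr (E.A * F.A)⁻¹, sigmaPlus E.A F.A) = E.traceOffset F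
    + crossRatioLinear (E.l - E.m) (E.n - E.m) (F.l - F.m) (F.n - F.m) (X1 E F, X2 E F) := by
  rw [tr_inv (SUJ.mul_mem E.mem F.mem), sigmaPlus, tr_inv E.mem, E.tr_mul, E.tr_inv_mul, E.tr_eq,
    F.tr_eq, traceOffset, crossRatioLinear_apply, Prod.mk_add_mk]
  simp only [map_add, map_sub, map_mul, Complex.conj_conj]
  congr 1 <;> ring

theorem exists_affineEquiv_apply_crossRatios (l l' : ℂ) : ∃ φ : (ℂ × ℂ) ≃ᵃ[ℝ] (ℂ × ℂ),
    ∀ E F : Loxodromic, E.l = l → F.l = l' →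
      (tr (E.A * F.A)⁻¹, sigmaPlus E.A F.A) = φ (X1 E F, X2 E F) := by
  by_cases h : ∃ E F : Loxodromic, E.l = l ∧ F.l = l'
  · obtain ⟨E, F, rfl, rfl⟩ := h
    refine ⟨(LinearEquiv.ofInjectiveEndo _ (crossRatioLinear_injective E.norm_n_sub_m_lt
      F.norm_n_sub_m_lt)).toAffineEquiv.trans (AffineEquiv.constVAdd ℝ _ (E.traceOffset F)),
      fun E' F' hE hF => ?_⟩
    rw [E'.tr_inv_sigmaPlus_eq]
    simp only [traceOffset, m_eq, n_eq, hE, hF]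
    rfl
  · exact ⟨AffineEquiv.refl ℝ _, fun E F hE hF => (h ⟨E, F, hE, hF⟩).elim⟩

end Loxodromic

/-- For loxodromic `A`, `B` with largest eigenvalues `l`, `l'`, the real-affine bijection that takes
`(X₁, X₂)` to `(tr C, σ₊)`. -/
noncomputable def crossRatioEquiv (l l' : ℂ) : (ℂ × ℂ) ≃ᵃ[ℝ] (ℂ × ℂ) :=
  (Loxodromic.exists_affineEquiv_apply_crossRatios l l').choose

theorem crossRatioEquiv_apply (E F : Loxodromic) :
    crossRatioEquiv E.l F.l (X1 E F, X2 E F) = (tr (E.A * F.A)⁻¹, sigmaPlus E.A F.A) :=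
  ((Loxodromic.exists_affineEquiv_apply_crossRatios E.l F.l).choose_spec E F rfl rfl).symm

/-- The change of coordinates from `(λ_A, λ_B, X₁, X₂)` to `(tr A, tr B, tr C, σ₊)`. -/
noncomputable def eigenToTrace (p : ℂ × ℂ × ℂ × ℂ) : ℂ × ℂ × ℂ × ℂ :=
  (traceOfEigenvalue p.1, traceOfEigenvalue p.2.1, crossRatioEquiv p.1 p.2.1 (p.2.2.1, p.2.2.2))

theorem eigenToTrace_eigenCoords (E F : Loxodromic) :
    eigenToTrace (eigenCoords E F) = traceCoords E.A F.A := by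
  rw [eigenToTrace, eigenCoords, crossRatioEquiv_apply, traceCoords, E.tr_eq_traceOfEigenvalue,
    F.tr_eq_traceOfEigenvalue]

theorem eigenCoords_eq_of_traceCoords_eq {E F E' F' : Loxodromic}
    (h : traceCoords E.A F.A = traceCoords E'.A F'.A) : eigenCoords E F = eigenCoords E' F' := by
  have hl : E.l = E'.l := Loxodromic.l_eq_of_tr_eq (congrArg Prod.fst h)
  have hl' : F.l = F'.l := Loxodromic.l_eq_of_tr_eq (congrArg (fun q => q.2.1) h)
  have hX : (tr (E.A * F.A)⁻¹, sigmaPlus E.A F.A) = (tr (E'.A * F'.A)⁻¹, sigmaPlus E'.A F'.A) :=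
    congrArg (fun q => q.2.2) h
  rw [← crossRatioEquiv_apply, ← crossRatioEquiv_apply, hl, hl'] at hX
  rw [eigenCoords, eigenCoords, hl, hl', (crossRatioEquiv E'.l F'.l).injective hX]

theorem bijOn_eigenToTrace :
    Set.BijOn eigenToTrace {p | ∃ E F : Loxodromic, p = eigenCoords E F}
      {q | ∃ A ∈ SUJ, ∃ B ∈ SUJ, IsLoxodromic A ∧ IsLoxodromic B ∧ q = traceCoords A B} := by
  refine ⟨?_, ?_, ?_⟩
  · rintro _ ⟨E, F, rfl⟩
    exact ⟨E.A, E.mem, F.A, F.mem, ⟨_, _, _, E.eigenvalues⟩, ⟨_, _, _, F.eigenvalues⟩,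
      eigenToTrace_eigenCoords E F⟩
  · rintro _ ⟨E, F, rfl⟩ _ ⟨E', F', rfl⟩ h
    rw [eigenToTrace_eigenCoords, eigenToTrace_eigenCoords] at h
    exact eigenCoords_eq_of_traceCoords_eq h
  · rintro _ ⟨A, hA, B, hB, hlA, hlB, rfl⟩
    obtain ⟨E, rfl⟩ := exists_loxodromic hA hlA
    obtain ⟨F, rfl⟩ := exists_loxodromic hB hlB
    exact ⟨_, ⟨E, F, rfl⟩, eigenToTrace_eigenCoords E F⟩

theorem sigmaMinus_eq {A B : SpecialLinearGroup (Fin 3) ℂ} (hA : A ∈ SUJ) (hB : B ∈ SUJ) :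
    sigmaMinus A B = conj (sigmaPlus A B) := by
  have h : B⁻¹ * A = (A⁻¹ * B)⁻¹ := by group
  rw [sigmaMinus, sigmaPlus, h, tr_inv (SUJ.mul_mem (SUJ.inv_mem hA) hB), tr_inv hA, tr_inv hB,
    map_sub, map_mul, Complex.conj_conj, mul_comm (tr A)]

theorem Q_eq_of_traceCoords_eq {A B A' B' : SpecialLinearGroup (Fin 3) ℂ} (hA : A ∈ SUJ)
    (hB : B ∈ SUJ) (hA' : A' ∈ SUJ) (hB' : B' ∈ SUJ) (h : traceCoords A B = traceCoords A' B') :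
    Q A B = Q A' B' := by
  simp only [traceCoords, Prod.mk.injEq] at h
  obtain ⟨h₁, h₂, h₃, h₄⟩ := h
  have h₇ : tr (A * B) = tr (A' * B') := by
    rw [tr_inv (SUJ.mul_mem hA hB), tr_inv (SUJ.mul_mem hA' hB')] at h₃
    exact (starRingEnd ℂ).injective h₃
  rw [Q, Q, sigmaMinus_eq hA hB, sigmaMinus_eq hA' hB', tr_inv hA, tr_inv hB, tr_inv hA',
    tr_inv hB', h₁, h₂, h₃, h₄, h₇]

theorem Q_eq_of_eigenCoords_eq {E F E' F' : Loxodromic}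
    (h : eigenCoords E F = eigenCoords E' F') : Q E.A F.A = Q E'.A F'.A := by
  refine Q_eq_of_traceCoords_eq E.mem F.mem E'.mem F'.mem ?_
  rw [← eigenToTrace_eigenCoords, h, eigenToTrace_eigenCoords]

theorem eq_iff_sign_im_eq_of_conj_pair_eq {t t' : ℂ}
    (h : ({t, conj t} : Multiset ℂ) = {t', conj t'}) :
    t = t' ↔ SignType.sign t.im = SignType.sign t'.im := by
  refine ⟨fun ht => by rw [ht], fun hs => ?_⟩
  have ht : t ∈ ({t', conj t'} : Multiset ℂ) := h ▸ Multiset.mem_cons_self _ _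
  rw [Multiset.insert_eq_cons, Multiset.mem_cons, Multiset.mem_singleton] at ht
  rcases ht with ht | rfl
  · exact ht
  · rw [Complex.conj_im, Left.sign_neg, SignType.neg_eq_self_iff, sign_eq_zero_iff] at hs
    exact Complex.conj_eq_iff_im.2 hs

end CrossRatioCoordinates

end ParkerPlatis

theorem mainTheorem11 :
    -- the denominators of `X₁` and `X₂` never vanish
    (∀ E : ParkerPlatis.Loxodromic, ParkerPlatis.form E.r E.a ≠ 0) ∧
    -- the bijection of coordinates, with its fibre depending only on the eigenvalues
    (∃ (τ : ℂ → ℂ) (φ : ℂ → ℂ → ((ℂ × ℂ) ≃ᵃ[ℝ] (ℂ × ℂ))),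
      Set.BijOn τ {l : ℂ | 1 < ‖l‖}
        {t : ℂ | ∃ A ∈ ParkerPlatis.SUJ, ParkerPlatis.IsLoxodromic A ∧ t = ParkerPlatis.tr A} ∧
      (∀ E F : ParkerPlatis.Loxodromic,
        ParkerPlatis.tr E.A = τ E.l ∧ ParkerPlatis.tr F.A = τ F.l ∧
        (ParkerPlatis.tr (E.A * F.A)⁻¹, ParkerPlatis.sigmaPlus E.A F.A) =
          φ E.l F.l (ParkerPlatis.X1 E F, ParkerPlatis.X2 E F)) ∧
      Set.BijOn
        (fun p : ℂ × ℂ × ℂ × ℂ => (τ p.1, τ p.2.1, φ p.1 p.2.1 (p.2.2.1, p.2.2.2)))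
        {p | ∃ E F : ParkerPlatis.Loxodromic, p = ParkerPlatis.eigenCoords E F}
        {q | ∃ A ∈ ParkerPlatis.SUJ, ∃ B ∈ ParkerPlatis.SUJ,
          ParkerPlatis.IsLoxodromic A ∧ ParkerPlatis.IsLoxodromic B ∧
            q = ParkerPlatis.traceCoords A B}) ∧
    -- the roots of the commutator quadratic
    (∀ E F : ParkerPlatis.Loxodromic,
      (ParkerPlatis.Q E.A F.A).roots =
        {ParkerPlatis.tr ⁅E.A, F.A⁆, conj (ParkerPlatis.tr ⁅E.A, F.A⁆)}) ∧
    -- the sign of `Im X₃` and the choice of a root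
    (∀ E F : ParkerPlatis.Loxodromic, ParkerPlatis.X3Defined E F →
      SignType.sign (ParkerPlatis.X3 E F).im =
        -SignType.sign (ParkerPlatis.tr ⁅E.A, F.A⁆).im) ∧
    (∀ E F E' F' : ParkerPlatis.Loxodromic,
      ParkerPlatis.X3Defined E F → ParkerPlatis.X3Defined E' F' →
      ParkerPlatis.eigenCoords E F = ParkerPlatis.eigenCoords E' F' →
      ParkerPlatis.Q E.A F.A = ParkerPlatis.Q E'.A F'.A ∧
      (SignType.sign (ParkerPlatis.X3 E F).im = SignType.sign (ParkerPlatis.X3 E' F').im ↔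
        ParkerPlatis.tr ⁅E.A, F.A⁆ = ParkerPlatis.tr ⁅E'.A, F'.A⁆)) := by
  refine ⟨fun E => E.form_r_a,
    ⟨ParkerPlatis.traceOfEigenvalue, ParkerPlatis.crossRatioEquiv,
      ParkerPlatis.bijOn_traceOfEigenvalue,
      fun E F => ⟨E.tr_eq_traceOfEigenvalue, F.tr_eq_traceOfEigenvalue,
        (ParkerPlatis.crossRatioEquiv_apply E F).symm⟩,
      ParkerPlatis.bijOn_eigenToTrace⟩,
    fun E F => E.roots_Q F.mem, fun E F => E.sign_im_X3 F, ?_⟩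
  intro E F E' F' h h' hcoords
  have hQ : ParkerPlatis.Q E.A F.A = ParkerPlatis.Q E'.A F'.A :=
    ParkerPlatis.Q_eq_of_eigenCoords_eq hcoords
  refine ⟨hQ, ?_⟩
  rw [E.sign_im_X3 F h, E'.sign_im_X3 F' h', neg_inj]
  refine (ParkerPlatis.eq_iff_sign_im_eq_of_conj_pair_eq ?_).symm
  rw [← E.roots_Q F.mem, ← E'.roots_Q F'.mem, hQ]
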